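/- A Lie groupoid $X_1\rightrightarrows X_0$ consists of finite-dimensional smooth manifolds $X_1$ (arrows) and $X_0$ (objects), surjective submersions $s,t:X_1\to X_0$ (source and target), and smooth composition $(p,q)\mapsto p*q$ (defined when $s(p)=t(q)$), unit $u:X_0\to X_1$ and inversion $i:X_1\to X_1$, subject to the groupoid axioms. A Lie 2-group $G_1\rightrightarrows G_0$ is a Lie groupoid in which $G_1$ and $G_0$ are Lie groups and all structural maps are group homomorphisms; for the composition this means $(g_1*g_2)\cdot(h_1*h_2)=(g_1\cdot h_1)*(g_2\cdot h_2)$ for composable pairs $(g_1,g_2)$ and $(h_1,h_2)$. A left 2-action of $G_1\rightrightarrows G_0$ on $X_1\rightrightarrows X_0$ is a Lie groupoid morphism $\theta=(\theta^1,\theta^0):(G_1\times X_1\rightrightarrows G_0\times X_0)\to(X_1\rightrightarrows X_0)$ such that $\theta^1$ and $\theta^0$ are left Lie group actions. A 1-metric on $X_1\rightrightarrows X_0$ is a Riemannian metric $\eta^{(1)}$ on $X_1$, together with the metric $\eta^{(0)}$ it induces on $X_0$, such that $s,t:(X_1,\eta^{(1)})\to(X_0,\eta^{(0)})$ are Riemannian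 submersions and $i$ is an isometry of $(X_1,\eta^{(1)})$. A 2-action is isometric for $\eta=(\eta^{(1)},\eta^{(0)})$ if $G_1$ acts by isometries on $(X_1,\eta^{(1)})$ and (as a consequence) $G_0$ acts by isometries on $(X_0,\eta^{(0)})$. The 2-group acts on itself by the left 2-action $L$, where $L^j_g(p)=g\cdot p$, and by the right 2-action $R$, where $R^j_g(p)=p\cdot g^{-1}$, for $g,p\in G_j$, $j=0,1$. A 1-metric on a Lie 2-group is bi-invariant if both $L$ and $R$ are isometric for it, and a Lie 2-group that admits a bi-invariant 1-metric is called orthogonal. Corollary. Every Lie 2-group $G_1\rightrightarrows G_0$ with $G_1$ compact admits a bi-invariant 1-metric $\eta$, that is, a 1-metric for which both the left and the right multiplication 2-actions $L$ and $R$ are isometric. In particular, $G_1\rightrightarrows G_0$ is orthogonal. -/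

import Mathlib

open scoped Manifold ContDiff

noncomputable section

section Groupoids

/-- A Lie groupoid `X₁ ⇉ X₀` with source `src`, target `tgt`, unit `unit`, inverse `inv` and
composition `comp`. Two arrows `p`, `q` are composable when `src p = tgt q`; the value `comp p q`
matters only on composable pairs. Source and target are surjective submersions, so the set of
composable pairs is an embedded submanifold of `X₁ × X₁`, and smoothness of the composition on this
submanifold is `ContMDiffOn` on that set. -/
structure LieGroupoid
    {E₁ : Type*} [NormedAddCommGroup E₁] [NormedSpace ℝ E₁] {H₁ : Type*} [TopologicalSpace H₁]
    (I₁ : ModelWithCorners ℝ E₁ H₁)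
    {E₀ : Type*} [NormedAddCommGroup E₀] [NormedSpace ℝ E₀] {H₀ : Type*} [TopologicalSpace H₀]
    (I₀ : ModelWithCorners ℝ E₀ H₀)
    (X₁ : Type*) [TopologicalSpace X₁] [ChartedSpace H₁ X₁] [IsManifold I₁ ∞ X₁]
    (X₀ : Type*) [TopologicalSpace X₀] [ChartedSpace H₀ X₀] [IsManifold I₀ ∞ X₀] where
  src : X₁ → X₀
  tgt : X₁ → X₀
  unit : X₀ → X₁
  inv : X₁ → X₁
  comp : X₁ → X₁ → X₁
  src_surjective : Function.Surjective src
  tgt_surjective : Function.Surjective tgt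
  src_submersion : Manifold.IsSubmersion I₁ I₀ ∞ src
  tgt_submersion : Manifold.IsSubmersion I₁ I₀ ∞ tgt
  unit_smooth : ContMDiff I₀ I₁ ∞ unit
  inv_smooth : ContMDiff I₁ I₁ ∞ inv
  comp_smooth : ContMDiffOn (I₁.prod I₁) I₁ ∞ (fun pq : X₁ × X₁ => comp pq.1 pq.2)
    {pq | src pq.1 = tgt pq.2}
  src_comp : ∀ p q, src p = tgt q → src (comp p q) = src q
  tgt_comp : ∀ p q, src p = tgt q → tgt (comp p q) = tgt p
  comp_assoc : ∀ p q r, src p = tgt q → src q = tgt r →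
    comp (comp p q) r = comp p (comp q r)
  src_unit : ∀ x, src (unit x) = x
  tgt_unit : ∀ x, tgt (unit x) = x
  comp_unit : ∀ p, comp p (unit (src p)) = p
  unit_comp : ∀ p, comp (unit (tgt p)) p = p
  src_inv : ∀ p, src (inv p) = tgt p
  tgt_inv : ∀ p, tgt (inv p) = src p
  comp_inv : ∀ p, comp p (inv p) = unit (tgt p)
  inv_comp : ∀ p, comp (inv p) p = unit (src p)

variable
    {E₁ : Type*} [NormedAddCommGroup E₁] [NormedSpace ℝ E₁] {H₁ : Type*} [TopologicalSpace H₁]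
    {I₁ : ModelWithCorners ℝ E₁ H₁}
    {E₀ : Type*} [NormedAddCommGroup E₀] [NormedSpace ℝ E₀] {H₀ : Type*} [TopologicalSpace H₀]
    {I₀ : ModelWithCorners ℝ E₀ H₀}
    {X₁ : Type*} [TopologicalSpace X₁] [ChartedSpace H₁ X₁] [IsManifold I₁ ∞ X₁]
    {X₀ : Type*} [TopologicalSpace X₀] [ChartedSpace H₀ X₀] [IsManifold I₀ ∞ X₀]
    {F₁ : Type*} [NormedAddCommGroup F₁] [NormedSpace ℝ F₁] {K₁ : Type*} [TopologicalSpace K₁]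
    {J₁ : ModelWithCorners ℝ F₁ K₁}
    {F₀ : Type*} [NormedAddCommGroup F₀] [NormedSpace ℝ F₀] {K₀ : Type*} [TopologicalSpace K₀]
    {J₀ : ModelWithCorners ℝ F₀ K₀}
    {Y₁ : Type*} [TopologicalSpace Y₁] [ChartedSpace K₁ Y₁] [IsManifold J₁ ∞ Y₁]
    {Y₀ : Type*} [TopologicalSpace Y₀] [ChartedSpace K₀ Y₀] [IsManifold J₀ ∞ Y₀]

/-- The product Lie groupoid `X₁ × Y₁ ⇉ X₀ × Y₀`, with componentwise structural maps. -/
def LieGroupoid.prod (X : LieGroupoid I₁ I₀ X₁ X₀) (Y : LieGroupoid J₁ J₀ Y₁ Y₀) :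
    LieGroupoid (I₁.prod J₁) (I₀.prod J₀) (X₁ × Y₁) (X₀ × Y₀) where
  src := Prod.map X.src Y.src
  tgt := Prod.map X.tgt Y.tgt
  unit := Prod.map X.unit Y.unit
  inv := Prod.map X.inv Y.inv
  comp p q := (X.comp p.1 q.1, Y.comp p.2 q.2)
  src_surjective := X.src_surjective.prodMap Y.src_surjective
  tgt_surjective := X.tgt_surjective.prodMap Y.tgt_surjective
  src_submersion := X.src_submersion.prodMap Y.src_submersion
  tgt_submersion := X.tgt_submersion.prodMap Y.tgt_submersion
  unit_smooth := X.unit_smooth.prodMap Y.unit_smooth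
  inv_smooth := X.inv_smooth.prodMap Y.inv_smooth
  comp_smooth := by
    refine ContMDiffOn.prodMk ?_ ?_
    · exact X.comp_smooth.comp (s := {pq : (X₁ × Y₁) × (X₁ × Y₁) |
          Prod.map X.src Y.src pq.1 = Prod.map X.tgt Y.tgt pq.2})
        (f := fun pq : (X₁ × Y₁) × (X₁ × Y₁) => (pq.1.1, pq.2.1))
        ((contMDiff_fst.comp contMDiff_fst).prodMk
          (contMDiff_fst.comp contMDiff_snd)).contMDiffOn
        (fun pq h => congrArg Prod.fst h)
    · exact Y.comp_smooth.comp (s := {pq : (X₁ × Y₁) × (X₁ × Y₁) |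
          Prod.map X.src Y.src pq.1 = Prod.map X.tgt Y.tgt pq.2})
        (f := fun pq : (X₁ × Y₁) × (X₁ × Y₁) => (pq.1.2, pq.2.2))
        ((contMDiff_snd.comp contMDiff_fst).prodMk
          (contMDiff_snd.comp contMDiff_snd)).contMDiffOn
        (fun pq h => congrArg Prod.snd h)
  src_comp p q h := Prod.ext (X.src_comp _ _ (congrArg Prod.fst h))
    (Y.src_comp _ _ (congrArg Prod.snd h))
  tgt_comp p q h := Prod.ext (X.tgt_comp _ _ (congrArg Prod.fst h))
    (Y.tgt_comp _ _ (congrArg Prod.snd h))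
  comp_assoc p q r h k := Prod.ext
    (X.comp_assoc _ _ _ (congrArg Prod.fst h) (congrArg Prod.fst k))
    (Y.comp_assoc _ _ _ (congrArg Prod.snd h) (congrArg Prod.snd k))
  src_unit x := Prod.ext (X.src_unit _) (Y.src_unit _)
  tgt_unit x := Prod.ext (X.tgt_unit _) (Y.tgt_unit _)
  comp_unit p := Prod.ext (X.comp_unit _) (Y.comp_unit _)
  unit_comp p := Prod.ext (X.unit_comp _) (Y.unit_comp _)
  src_inv p := Prod.ext (X.src_inv _) (Y.src_inv _)
  tgt_inv p := Prod.ext (X.tgt_inv _) (Y.tgt_inv _)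
  comp_inv p := Prod.ext (X.comp_inv _) (Y.comp_inv _)
  inv_comp p := Prod.ext (X.inv_comp _) (Y.inv_comp _)

/-- A morphism of Lie groupoids: smooth maps on arrows and on objects which commute with source and
target and preserve compositions. -/
structure LieGroupoidHom (X : LieGroupoid I₁ I₀ X₁ X₀) (Y : LieGroupoid J₁ J₀ Y₁ Y₀) where
  arr : X₁ → Y₁
  obj : X₀ → Y₀
  arr_smooth : ContMDiff I₁ J₁ ∞ arr
  obj_smooth : ContMDiff I₀ J₀ ∞ obj
  src_arr : ∀ p, Y.src (arr p) = obj (X.src p)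
  tgt_arr : ∀ p, Y.tgt (arr p) = obj (X.tgt p)
  arr_comp : ∀ p q, X.src p = X.tgt q → arr (X.comp p q) = Y.comp (arr p) (arr q)

end Groupoids

section TwoGroups

/-- A Lie 2-group: a Lie groupoid `G₁ ⇉ G₀` whose spaces of arrows and of objects are Lie groups and
whose structural maps are all group homomorphisms. For the composition, defined on the subgroup of
composable pairs in `G₁ × G₁`, this is the interchange law `comp_mul`. -/
structure LieTwoGroup
    {E₁ : Type*} [NormedAddCommGroup E₁] [NormedSpace ℝ E₁] {H₁ : Type*} [TopologicalSpace H₁]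
    (I₁ : ModelWithCorners ℝ E₁ H₁)
    {E₀ : Type*} [NormedAddCommGroup E₀] [NormedSpace ℝ E₀] {H₀ : Type*} [TopologicalSpace H₀]
    (I₀ : ModelWithCorners ℝ E₀ H₀)
    (G₁ : Type*) [Group G₁] [TopologicalSpace G₁] [ChartedSpace H₁ G₁] [LieGroup I₁ ∞ G₁]
    (G₀ : Type*) [Group G₀] [TopologicalSpace G₀] [ChartedSpace H₀ G₀] [LieGroup I₀ ∞ G₀]
    extends LieGroupoid I₁ I₀ G₁ G₀ where
  src_mul : ∀ g h, src (g * h) = src g * src h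
  tgt_mul : ∀ g h, tgt (g * h) = tgt g * tgt h
  unit_mul : ∀ a b, unit (a * b) = unit a * unit b
  inv_mul : ∀ g h, inv (g * h) = inv g * inv h
  comp_mul : ∀ g₁ g₂ h₁ h₂, src g₁ = tgt g₂ → src h₁ = tgt h₂ →
    comp g₁ g₂ * comp h₁ h₂ = comp (g₁ * h₁) (g₂ * h₂)

variable
    {E₁ : Type*} [NormedAddCommGroup E₁] [NormedSpace ℝ E₁] {H₁ : Type*} [TopologicalSpace H₁]
    {I₁ : ModelWithCorners ℝ E₁ H₁}
    {E₀ : Type*} [NormedAddCommGroup E₀] [NormedSpace ℝ E₀] {H₀ : Type*} [TopologicalSpace H₀]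
    {I₀ : ModelWithCorners ℝ E₀ H₀}
    {G₁ : Type*} [Group G₁] [TopologicalSpace G₁] [ChartedSpace H₁ G₁] [LieGroup I₁ ∞ G₁]
    {G₀ : Type*} [Group G₀] [TopologicalSpace G₀] [ChartedSpace H₀ G₀] [LieGroup I₀ ∞ G₀]
    {F₁ : Type*} [NormedAddCommGroup F₁] [NormedSpace ℝ F₁] {K₁ : Type*} [TopologicalSpace K₁]
    {J₁ : ModelWithCorners ℝ F₁ K₁}
    {F₀ : Type*} [NormedAddCommGroup F₀] [NormedSpace ℝ F₀] {K₀ : Type*} [TopologicalSpace K₀]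
    {J₀ : ModelWithCorners ℝ F₀ K₀}
    {X₁ : Type*} [TopologicalSpace X₁] [ChartedSpace K₁ X₁] [IsManifold J₁ ∞ X₁]
    {X₀ : Type*} [TopologicalSpace X₀] [ChartedSpace K₀ X₀] [IsManifold J₀ ∞ X₀]

/-- A left 2-action of a Lie 2-group `G₁ ⇉ G₀` on a Lie groupoid `X₁ ⇉ X₀`: a morphism of Lie
groupoids from the product groupoid `G₁ × X₁ ⇉ G₀ × X₀` to `X₁ ⇉ X₀` which is a left group action
on arrows and on objects. -/
structure LieTwoAction (G : LieTwoGroup I₁ I₀ G₁ G₀) (X : LieGroupoid J₁ J₀ X₁ X₀)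
    extends LieGroupoidHom (G.toLieGroupoid.prod X) X where
  one_arr : ∀ p, arr (1, p) = p
  mul_arr : ∀ g h p, arr (g * h, p) = arr (g, arr (h, p))
  one_obj : ∀ x, obj (1, x) = x
  mul_obj : ∀ a b x, obj (a * b, x) = obj (a, obj (b, x))

namespace LieTwoGroup

variable (G : LieTwoGroup I₁ I₀ G₁ G₀)

theorem src_one : G.src 1 = 1 := (MonoidHom.mk' G.src G.src_mul).map_one

theorem tgt_one : G.tgt 1 = 1 := (MonoidHom.mk' G.tgt G.tgt_mul).map_one

theorem unit_one : G.unit 1 = 1 := (MonoidHom.mk' G.unit G.unit_mul).map_one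

theorem src_group_inv (g : G₁) : G.src g⁻¹ = (G.src g)⁻¹ :=
  (MonoidHom.mk' G.src G.src_mul).map_inv g

theorem tgt_group_inv (g : G₁) : G.tgt g⁻¹ = (G.tgt g)⁻¹ :=
  (MonoidHom.mk' G.tgt G.tgt_mul).map_inv g

theorem comp_one_one : G.comp 1 1 = 1 := by
  have h := G.comp_unit 1
  rwa [G.src_one, G.unit_one] at h

theorem comp_group_inv (g h : G₁) (hgh : G.src g = G.tgt h) :
    (G.comp g h)⁻¹ = G.comp g⁻¹ h⁻¹ := by
  rw [inv_eq_iff_mul_eq_one, G.comp_mul _ _ _ _ hgh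
    (by rw [G.src_group_inv, G.tgt_group_inv, hgh]), mul_inv_cancel, mul_inv_cancel,
    G.comp_one_one]

/-- The 2-action of a Lie 2-group on itself by left multiplications `(g, p) ↦ g * p`. -/
def leftAction : LieTwoAction G G.toLieGroupoid where
  arr p := p.1 * p.2
  obj x := x.1 * x.2
  arr_smooth := contMDiff_mul I₁ ∞
  obj_smooth := contMDiff_mul I₀ ∞
  src_arr _ := G.src_mul _ _
  tgt_arr _ := G.tgt_mul _ _
  arr_comp _ _ h := G.comp_mul _ _ _ _ (congrArg Prod.fst h) (congrArg Prod.snd h)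
  one_arr := one_mul
  mul_arr := mul_assoc
  one_obj := one_mul
  mul_obj := mul_assoc

/-- The 2-action of a Lie 2-group on itself by right multiplications, written as a left 2-action
`(g, p) ↦ p * g⁻¹`. -/
def rightAction : LieTwoAction G G.toLieGroupoid where
  arr p := p.2 * p.1⁻¹
  obj x := x.2 * x.1⁻¹
  arr_smooth := contMDiff_snd.mul (contMDiff_fst.inv)
  obj_smooth := contMDiff_snd.mul (contMDiff_fst.inv)
  src_arr p := by
    rw [G.src_mul, G.src_group_inv]; rfl
  tgt_arr p := by
    rw [G.tgt_mul, G.tgt_group_inv]; rfl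
  arr_comp p q h := by
    have h₁ : G.src p.1 = G.tgt q.1 := congrArg Prod.fst h
    have h₂ : G.src p.2 = G.tgt q.2 := congrArg Prod.snd h
    change G.comp p.2 q.2 * (G.comp p.1 q.1)⁻¹ = _
    rw [G.comp_group_inv _ _ h₁, G.comp_mul _ _ _ _ h₂
      (by rw [G.src_group_inv, G.tgt_group_inv, h₁])]
  one_arr p := by simp
  mul_arr g h p := by simp [mul_assoc]
  one_obj x := by simp
  mul_obj a b x := by simp [mul_assoc]

end LieTwoGroup

end TwoGroups

section Metrics

/-- A smooth Riemannian metric on a manifold. -/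
abbrev SmoothMetric {E : Type*} [NormedAddCommGroup E] [NormedSpace ℝ E]
    {H : Type*} [TopologicalSpace H] (I : ModelWithCorners ℝ E H)
    (M : Type*) [TopologicalSpace M] [ChartedSpace H M] [IsManifold I ∞ M] :=
  Bundle.ContMDiffRiemannianMetric I ∞ E (fun x : M => TangentSpace I x)

/-- `f` is an isometry of the Riemannian manifold `(M, η)` onto itself: a diffeomorphism with
`f^* η = η`. -/
def IsMetricIsometry {E : Type*} [NormedAddCommGroup E] [NormedSpace ℝ E]
    {H : Type*} [TopologicalSpace H] {I : ModelWithCorners ℝ E H}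
    {M : Type*} [TopologicalSpace M] [ChartedSpace H M] [IsManifold I ∞ M]
    (η : SmoothMetric I M) (f : M → M) : Prop :=
  (∃ Φ : M ≃ₘ^∞⟮I, I⟯ M, ⇑Φ = f) ∧
    ∀ (x : M) (v w : TangentSpace I x),
      η.inner (f x) (mfderiv I I f x v) (mfderiv I I f x w) = η.inner x v w

/-- `π : (M, η) → (N, ζ)` is a Riemannian submersion: a surjective submersion whose differential at
every point `x` is isometric on the orthogonal complement of its kernel. -/
structure IsRiemannianSubmersion {E : Type*} [NormedAddCommGroup E] [NormedSpace ℝ E]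
    {H : Type*} [TopologicalSpace H] {I : ModelWithCorners ℝ E H}
    {M : Type*} [TopologicalSpace M] [ChartedSpace H M] [IsManifold I ∞ M]
    {F : Type*} [NormedAddCommGroup F] [NormedSpace ℝ F]
    {K : Type*} [TopologicalSpace K] {J : ModelWithCorners ℝ F K}
    {N : Type*} [TopologicalSpace N] [ChartedSpace K N] [IsManifold J ∞ N]
    (η : SmoothMetric I M) (ζ : SmoothMetric J N) (π : M → N) : Prop where
  surjective : Function.Surjective π
  submersion : Manifold.IsSubmersion I J ∞ π
  isometric : ∀ (x : M) (v w : TangentSpace I x),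
    (∀ k : TangentSpace I x, mfderiv I J π x k = 0 → η.inner x v k = 0) →
    (∀ k : TangentSpace I x, mfderiv I J π x k = 0 → η.inner x w k = 0) →
    ζ.inner (π x) (mfderiv I J π x v) (mfderiv I J π x w) = η.inner x v w

variable
    {E₁ : Type*} [NormedAddCommGroup E₁] [NormedSpace ℝ E₁] {H₁ : Type*} [TopologicalSpace H₁]
    {I₁ : ModelWithCorners ℝ E₁ H₁}
    {E₀ : Type*} [NormedAddCommGroup E₀] [NormedSpace ℝ E₀] {H₀ : Type*} [TopologicalSpace H₀]
    {I₀ : ModelWithCorners ℝ E₀ H₀}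
    {G₁ : Type*} [Group G₁] [TopologicalSpace G₁] [ChartedSpace H₁ G₁] [LieGroup I₁ ∞ G₁]
    {G₀ : Type*} [Group G₀] [TopologicalSpace G₀] [ChartedSpace H₀ G₀] [LieGroup I₀ ∞ G₀]
    {F₁ : Type*} [NormedAddCommGroup F₁] [NormedSpace ℝ F₁] {K₁ : Type*} [TopologicalSpace K₁]
    {J₁ : ModelWithCorners ℝ F₁ K₁}
    {F₀ : Type*} [NormedAddCommGroup F₀] [NormedSpace ℝ F₀] {K₀ : Type*} [TopologicalSpace K₀]
    {J₀ : ModelWithCorners ℝ F₀ K₀}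
    {X₁ : Type*} [TopologicalSpace X₁] [ChartedSpace K₁ X₁] [IsManifold J₁ ∞ X₁]
    {X₀ : Type*} [TopologicalSpace X₀] [ChartedSpace K₀ X₀] [IsManifold J₀ ∞ X₀]

/-- A 1-metric on a Lie groupoid: a Riemannian metric on the arrows, together with the metric that
it induces on the objects, such that source and target are Riemannian submersions and the groupoid
inversion is an isometry. The metric on objects is determined by the metric on arrows, as its
push-forward along the source or the target. -/
structure OneMetric (X : LieGroupoid J₁ J₀ X₁ X₀) where
  arrMetric : SmoothMetric J₁ X₁
  objMetric : SmoothMetric J₀ X₀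
  src_riemannian : IsRiemannianSubmersion arrMetric objMetric X.src
  tgt_riemannian : IsRiemannianSubmersion arrMetric objMetric X.tgt
  inv_isometry : IsMetricIsometry arrMetric X.inv

/-- A 2-action on a Lie groupoid with a 1-metric is isometric if arrows act by isometries on the
space of arrows and objects act by isometries on the space of objects. (The second condition is a
consequence of the first.) -/
structure LieTwoAction.IsIsometric {G : LieTwoGroup I₁ I₀ G₁ G₀} {X : LieGroupoid J₁ J₀ X₁ X₀}
    (θ : LieTwoAction G X) (η : OneMetric X) : Prop where
  arr_isometry : ∀ g : G₁, IsMetricIsometry η.arrMetric (fun p : X₁ => θ.arr (g, p))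
  obj_isometry : ∀ a : G₀, IsMetricIsometry η.objMetric (fun x : X₀ => θ.obj (a, x))

/-- A 1-metric on a Lie 2-group is bi-invariant if the 2-actions of the 2-group on itself by left
and by right multiplications are both isometric. -/
structure LieTwoGroup.IsBiInvariant (G : LieTwoGroup I₁ I₀ G₁ G₀)
    (η : OneMetric G.toLieGroupoid) : Prop where
  left_isometric : G.leftAction.IsIsometric η
  right_isometric : G.rightAction.IsIsometric η

/-- A Lie 2-group is orthogonal if it carries a bi-invariant 1-metric. -/
def LieTwoGroup.IsOrthogonal (G : LieTwoGroup I₁ I₀ G₁ G₀) : Prop :=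
  ∃ η : OneMetric G.toLieGroupoid, G.IsBiInvariant η

end Metrics

end

/-!
A scalar product on the tangent space `𝔤₁ = T₁G₁` extends uniquely to a left-invariant metric on
`G₁`, and everything required of a bi-invariant 1-metric can be read off at the identity, through
the Maurer–Cartan form. Right invariance amounts to invariance under the adjoint representation
(`isMetricIsometry_mul_right`), and the groupoid inversion `i`, being a group automorphism, is an
isometry when its differential `di` at the identity preserves the scalar product
(`isMetricIsometry_of_involutive_hom`).

Since `G₁` is compact, averaging with respect to Haar measure gives an `Ad`-invariant scalar product
`B` (`exists_isScalarProduct_invariant`). As `di ∘ Ad g = Ad (i g) ∘ di` and `i` is an involution,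
`B + di^* B` is invariant under both `Ad` and `di`
(`LieTwoGroup.exists_isScalarProduct_adjoint_inv`).

The differential `ds` of the source is surjective at the identity, because the unit is a section of
the source. On `T₁G₀` take the quotient scalar product along `ds`
(`IsScalarProduct.exists_quotient`) and extend it by left translations. It is invariant under
`Ad (s g)` because `Ad g` preserves the kernel of `ds` and its orthogonal complement, and every
object is of the form `s g`. The source is then a Riemannian submersion
(`isRiemannianSubmersion_hom`), and so is the target, since `t = s ∘ i`.
-/

open scoped Manifold ContDiff

noncomputable section

/-! ### Scalar products on finite-dimensional spaces -/

section ScalarProduct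

variable {E : Type*} [NormedAddCommGroup E] [NormedSpace ℝ E]
  {F : Type*} [NormedAddCommGroup F] [NormedSpace ℝ F]

/-- A symmetric positive definite bilinear form, as a bare form: the norm of `E` is unrelated to
it. -/
structure IsScalarProduct (B : E →L[ℝ] E →L[ℝ] ℝ) : Prop where
  symm : ∀ v w, B v w = B w v
  pos : ∀ v, v ≠ 0 → 0 < B v v

theorem exists_isScalarProduct (E : Type*) [NormedAddCommGroup E] [NormedSpace ℝ E]
    [FiniteDimensional ℝ E] : ∃ B : E →L[ℝ] E →L[ℝ] ℝ, IsScalarProduct B := by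
  refine ⟨(innerSL ℝ).bilinearComp (toEuclidean (E := E)).toContinuousLinearMap
    (toEuclidean (E := E)).toContinuousLinearMap, fun v w => ?_, fun v hv => ?_⟩
  · simp [real_inner_comm]
  · have : toEuclidean v ≠ 0 := by simpa using hv
    exact real_inner_self_pos.mpr this

namespace IsScalarProduct

variable {B : E →L[ℝ] E →L[ℝ] ℝ}

theorem eq_zero_of_self (hB : IsScalarProduct B) {v : E} (h : B v v = 0) : v = 0 := by
  by_contra hv
  exact (hB.pos v hv).ne' h

theorem bilinearComp (hB : IsScalarProduct B) (A : F →L[ℝ] E) (hA : Function.Injective A) :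
    IsScalarProduct (B.bilinearComp A A) where
  symm _ _ := hB.symm _ _
  pos _ hv := hB.pos _ fun h => hv (hA (h.trans A.map_zero.symm))

theorem add {B' : E →L[ℝ] E →L[ℝ] ℝ} (hB : IsScalarProduct B) (hB' : IsScalarProduct B') :
    IsScalarProduct (B + B') where
  symm v w := by simp [hB.symm v w, hB'.symm v w]
  pos v hv := add_pos (hB.pos v hv) (hB'.pos v hv)

/-- On the unit sphere, which is compact, `B v v` is bounded below by a positive constant. -/
theorem isVonNBounded [FiniteDimensional ℝ E] (hB : IsScalarProduct B) :
    Bornology.IsVonNBounded ℝ {v : E | B v v < 1} := by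
  have hcont : Continuous fun v : E => B v v := by fun_prop
  obtain ⟨c, hc, hbd⟩ : ∃ c : ℝ, 0 < c ∧ ∀ v : E, c * ‖v‖ ^ 2 ≤ B v v := by
    rcases (Metric.sphere (0 : E) 1).eq_empty_or_nonempty with h | h
    · refine ⟨1, one_pos, fun v => ?_⟩
      have hv : v = 0 := by
        by_contra hv
        have : ‖v‖⁻¹ • v ∈ Metric.sphere (0 : E) 1 := by
          simp [norm_smul, norm_ne_zero_iff.mpr hv]
        rw [h] at this
        exact this
      simp [hv]
    · obtain ⟨u, hu, hmin⟩ := (isCompact_sphere (0 : E) 1).exists_isMinOn h hcont.continuousOn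
      have hu1 : ‖u‖ = 1 := by simpa using hu
      refine ⟨B u u, hB.pos u (norm_ne_zero_iff.mp (by simp [hu1])), fun v => ?_⟩
      by_cases hv : v = 0
      · simp [hv]
      have hn : ‖v‖ ≠ 0 := norm_ne_zero_iff.mpr hv
      have h1 : ‖v‖⁻¹ • v ∈ Metric.sphere (0 : E) 1 := by simp [norm_smul, hn]
      have h2 : B u u ≤ B (‖v‖⁻¹ • v) (‖v‖⁻¹ • v) := hmin h1
      calc B u u * ‖v‖ ^ 2 ≤ B (‖v‖⁻¹ • v) (‖v‖⁻¹ • v) * ‖v‖ ^ 2 := by gcongr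
        _ = B v v := by
          simp only [map_smul, smul_apply, smul_eq_mul]
          field_simp
  refine NormedSpace.isVonNBounded_of_isBounded ℝ
    (isBounded_iff_forall_norm_le.mpr ⟨Real.sqrt (1 / c), fun v hv => ?_⟩)
  refine Real.le_sqrt_of_sq_le ?_
  rw [le_div_iff₀ hc, mul_comm]
  exact (hbd v).trans (le_of_lt hv)

theorem isCompl_ker_orthogonal [FiniteDimensional ℝ E] (hB : IsScalarProduct B)
    (S : E →L[ℝ] F) :
    IsCompl S.toLinearMap.ker (B.toBilinForm.orthogonal S.toLinearMap.ker) := by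
  have hrefl : B.toBilinForm.IsRefl := fun v w h => (hB.symm w v).trans h
  rw [LinearMap.BilinForm.isCompl_orthogonal_iff_disjoint hrefl, Submodule.disjoint_def]
  intro v hv hv'
  exact hB.eq_zero_of_self (hv' v hv)

/-- The quotient scalar product: a surjection `S` pushes `B` forward to the scalar product which
makes `S` isometric on the orthogonal complement of its kernel. The second conclusion records that
each vector of `F` has a horizontal lift. -/
theorem exists_quotient [FiniteDimensional ℝ E] [FiniteDimensional ℝ F] (hB : IsScalarProduct B)
    (S : E →L[ℝ] F) (hS : Function.Surjective S) :
    ∃ B' : F →L[ℝ] F →L[ℝ] ℝ, IsScalarProduct B' ∧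
      (∀ f, ∃ v, S v = f ∧ ∀ k, S k = 0 → B v k = 0) ∧
      ∀ v w, (∀ k, S k = 0 → B v k = 0) → (∀ k, S k = 0 → B w k = 0) →
        B' (S v) (S w) = B v w := by
  have hc := (hB.isCompl_ker_orthogonal S).symm
  -- the section `σ` of `S` with values in the orthogonal complement of the kernel
  obtain ⟨τ, hτ⟩ := S.toLinearMap.exists_rightInverse_of_surjective
    (LinearMap.range_eq_top.mpr hS)
  let W := B.toBilinForm.orthogonal S.toLinearMap.ker
  let P : E →ₗ[ℝ] W := W.projectionOnto _ hc
  let σ : F →L[ℝ] E := (W.subtype ∘ₗ P ∘ₗ τ).toContinuousLinearMap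
  have hSP : ∀ v, S (P v : E) = S v := by
    intro v
    have : v - (P v : E) ∈ S.toLinearMap.ker := by
      rw [← Submodule.ker_projectionOnto hc, LinearMap.mem_ker, map_sub,
        Submodule.projectionOnto_apply_left hc]
      exact sub_self (P v)
    have h : S (v - (P v : E)) = 0 := this
    rw [map_sub, sub_eq_zero] at h
    exact h.symm
  have hSσ : ∀ f, S (σ f) = f := fun f => (hSP _).trans (LinearMap.congr_fun hτ f)
  have hσ : ∀ f k, S k = 0 → B (σ f) k = 0 := fun f k hk =>
    (hB.symm _ _).trans ((P (τ f)).2 k hk)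
  have hσS : ∀ v, (∀ k, S k = 0 → B v k = 0) → σ (S v) = v := by
    intro v hv
    rw [← sub_eq_zero]
    have hk : S (σ (S v) - v) = 0 := by rw [map_sub, hSσ, sub_self]
    refine hB.eq_zero_of_self ?_
    rw [hB.symm]
    conv_lhs => rw [map_sub]
    rw [hB.symm, hσ _ _ hk, hB.symm, hv _ hk, sub_zero]
  refine ⟨B.bilinearComp σ σ, hB.bilinearComp σ (Function.LeftInverse.injective hSσ),
    fun f => ⟨σ f, hSσ f, hσ f⟩, fun v w hv hw => ?_⟩
  rw [ContinuousLinearMap.bilinearComp_apply, hσS v hv, hσS w hw]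

end IsScalarProduct

/-- Averaging over a compact group with respect to Haar measure: a continuous representation
preserves a scalar product. -/
theorem exists_isScalarProduct_invariant {G : Type*} [Group G] [TopologicalSpace G]
    [IsTopologicalGroup G] [CompactSpace G] [FiniteDimensional ℝ E]
    (ρ : G →* (E →L[ℝ] E)) (hρ : Continuous ρ) :
    ∃ B : E →L[ℝ] E →L[ℝ] ℝ, IsScalarProduct B ∧ ∀ g v w, B (ρ g v) (ρ g w) = B v w := by
  obtain ⟨B, hB⟩ := exists_isScalarProduct E
  borelize G
  let μ : MeasureTheory.Measure G := MeasureTheory.Measure.haar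
  let b : E → E → G → ℝ := fun v w g => B (ρ g⁻¹ v) (ρ g⁻¹ w)
  have hρ' : Continuous fun g => ρ g⁻¹ := hρ.comp continuous_inv
  have hb : ∀ v w, Continuous (b v w) := fun v w => by
    have hv : ∀ u, Continuous fun g => ρ g⁻¹ u := fun u => hρ'.clm_apply continuous_const
    exact (B.continuous.comp (hv v)).clm_apply (hv w)
  have hint : ∀ v w, MeasureTheory.Integrable (b v w) μ := fun v w =>
    (hb v w).integrable_of_hasCompactSupport (HasCompactSupport.of_compactSpace _)
  let β : E →ₗ[ℝ] E →ₗ[ℝ] ℝ := LinearMap.mk₂ ℝ (fun v w => ∫ g, b v w g ∂μ)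
    (fun v v' w => by
      rw [← MeasureTheory.integral_add (hint v w) (hint v' w)]
      simp [b])
    (fun c v w => by
      rw [← MeasureTheory.integral_smul]
      simp [b])
    (fun v w w' => by
      rw [← MeasureTheory.integral_add (hint v w) (hint v w')]
      simp [b])
    (fun c v w => by
      rw [← MeasureTheory.integral_smul]
      simp [b])
  have happ : ∀ v w, LinearMap.toContinuousBilinearMap β v w = ∫ g, b v w g ∂μ :=
    fun v w => rfl
  refine ⟨LinearMap.toContinuousBilinearMap β, ⟨fun v w => ?_, fun v hv => ?_⟩, fun h v w => ?_⟩
  · rw [happ, happ]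
    exact MeasureTheory.integral_congr_ae (.of_forall fun g => hB.symm _ _)
  · have hinj : ∀ g, ρ g v ≠ 0 := fun g hg => hv <| by
      have : ρ g⁻¹ (ρ g v) = v := by
        rw [← mul_apply_eq_comp, ← map_mul, inv_mul_cancel, map_one]; rfl
      rw [← this, hg, map_zero]
    rw [happ]
    exact (hb v v).integral_pos_of_hasCompactSupport_nonneg_nonzero (HasCompactSupport.of_compactSpace _)
      (fun g => (hB.pos _ (hinj _)).le) (x := 1) (hB.pos _ (hinj _)).ne'
  · rw [happ, happ, ← MeasureTheory.integral_mul_left_eq_self (b v w) h⁻¹]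
    refine MeasureTheory.integral_congr_ae (.of_forall fun g => ?_)
    have : ∀ u, ρ g⁻¹ (ρ h u) = ρ (h⁻¹ * g)⁻¹ u := fun u => by
      rw [← mul_apply_eq_comp, ← map_mul, mul_inv_rev, inv_inv]
    simp only [b, this]

end ScalarProduct

/-! ### The Maurer–Cartan form and the adjoint representation -/

section LieGroup

variable {E : Type*} [NormedAddCommGroup E] [NormedSpace ℝ E]
  {H : Type*} [TopologicalSpace H] (I : ModelWithCorners ℝ E H)
  {G : Type*} [Group G] [TopologicalSpace G] [ChartedSpace H G] [LieGroup I ∞ G]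
  {F : Type*} [NormedAddCommGroup F] [NormedSpace ℝ F]
  {K : Type*} [TopologicalSpace K] (J : ModelWithCorners ℝ F K)
  {N : Type*} [Group N] [TopologicalSpace N] [ChartedSpace K N] [LieGroup J ∞ N]

/-- The Maurer–Cartan form: the differential at `g` of left translation by `g⁻¹`. Both tangent
spaces, at `g` and at `g⁻¹ * g`, are the model space `E` by definition. -/
def maurerCartan (g : G) : E →L[ℝ] E :=
  (mfderiv I I (fun y : G => g⁻¹ * y) g :)

/-- The differential of `φ` at `1`, as a map between the model spaces. It is meant for `φ 1 = 1`, so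
that both sides stand for tangent spaces at the identity. -/
def mfderivOne (φ : G → N) : E →L[ℝ] F :=
  (mfderiv I J φ (1 : G) :)

theorem mdifferentiable_mul_left_of_lieGroup (g : G) : MDifferentiable I I (fun y : G => g * y) :=
  (contMDiff_mul_left (I := I) (n := ∞) (a := g)).mdifferentiable (by simp)

theorem maurerCartan_mul_left (h g : G) (v : TangentSpace I g) :
    maurerCartan I (h * g) (mfderiv I I (fun y : G => h * y) g v) = maurerCartan I g v := by
  have hf : (fun y : G => g⁻¹ * y) = (fun y : G => (h * g)⁻¹ * y) ∘ fun y : G => h * y := by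
    ext y; simp [mul_assoc]
  have := mfderiv_comp_apply (x := g) (mdifferentiable_mul_left_of_lieGroup I (h * g)⁻¹ _)
    (mdifferentiable_mul_left_of_lieGroup I h g) v
  rw [← hf] at this
  exact this.symm

/-- The differential form of `(φ g)⁻¹ * φ y = φ (g⁻¹ * y)`. -/
theorem maurerCartan_hom (φ : G → N) (hφ : ∀ g h, φ (g * h) = φ g * φ h)
    (hs : ContMDiff I J ∞ φ) (g : G) (v : TangentSpace I g) :
    maurerCartan J (φ g) (mfderiv I J φ g v) = mfderivOne I J φ (maurerCartan I g v) := by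
  have hd := hs.mdifferentiable (by simp)
  have hf : (fun y : N => (φ g)⁻¹ * y) ∘ φ = φ ∘ fun y : G => g⁻¹ * y := by
    ext y
    have := hφ g (g⁻¹ * y)
    rw [mul_inv_cancel_left] at this
    simp [this]
  have h1 := mfderiv_comp_apply (x := g) (mdifferentiable_mul_left_of_lieGroup J (φ g)⁻¹ _) (hd g) v
  have h2 := mfderiv_comp_apply_of_eq (x := g) (hd 1) (mdifferentiable_mul_left_of_lieGroup I g⁻¹ g)
    (inv_mul_cancel g) v
  rw [hf] at h1
  exact h1.symm.trans h2

variable {I} in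
theorem mfderiv_apply_of_eq_id {M : Type*} [TopologicalSpace M] [ChartedSpace H M]
    {f : M → M} (hf : f = id) (x : M) (v : E) : (mfderiv I I f x :) v = v := by
  subst hf
  exact congrArg (· v) (mfderiv_id (I := I) (x := x))

theorem maurerCartan_bijective (g : G) : Function.Bijective (maurerCartan I g) := by
  refine ⟨Function.LeftInverse.injective (g := (mfderiv I I (fun y : G => g * y) 1 :)) fun v => ?_,
    fun w => ⟨(mfderiv I I (fun y : G => g * y) (1 : G) :) w, ?_⟩⟩
  · have h := mfderiv_comp_apply_of_eq (x := g) (mdifferentiable_mul_left_of_lieGroup I g 1)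
      (mdifferentiable_mul_left_of_lieGroup I g⁻¹ g) (inv_mul_cancel g) v
    have h' := mfderiv_apply_of_eq_id (I := I)
      (f := (fun y : G => g * y) ∘ fun y : G => g⁻¹ * y) (by ext; simp) g v
    exact h.symm.trans h'
  · have h := mfderiv_comp_apply_of_eq (x := (1 : G)) (mdifferentiable_mul_left_of_lieGroup I g⁻¹ g)
      (mdifferentiable_mul_left_of_lieGroup I g 1) (mul_one g) w
    have h' := mfderiv_apply_of_eq_id (I := I)
      (f := (fun y : G => g⁻¹ * y) ∘ fun y : G => g * y) (by ext; simp) 1 w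
    exact h.symm.trans h'

/-- The Maurer–Cartan form carries the kernel of the differential of `φ` at `g` onto the kernel of
its differential at `1`. -/
theorem mfderivOne_maurerCartan_eq_zero_iff (φ : G → N) (hφ : ∀ g h, φ (g * h) = φ g * φ h)
    (hs : ContMDiff I J ∞ φ) (g : G) (v : TangentSpace I g) :
    mfderivOne I J φ (maurerCartan I g v) = 0 ↔ mfderiv I J φ g v = 0 := by
  rw [← maurerCartan_hom I J φ hφ hs]
  exact map_eq_zero_iff _ (maurerCartan_bijective J (φ g)).1

omit [LieGroup I ∞ G] [LieGroup J ∞ N] in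
theorem mfderivOne_comp {E' : Type*} [NormedAddCommGroup E'] [NormedSpace ℝ E']
    {H' : Type*} [TopologicalSpace H'] {I' : ModelWithCorners ℝ E' H'}
    {M : Type*} [Group M] [TopologicalSpace M] [ChartedSpace H' M]
    {ψ : N → M} {φ : G → N} (hψ : ContMDiff J I' ∞ ψ) (hφ : ContMDiff I J ∞ φ) (h1 : φ 1 = 1)
    (v : E) : mfderivOne I I' (ψ ∘ φ) v = mfderivOne J I' ψ (mfderivOne I J φ v) :=
  mfderiv_comp_apply_of_eq (x := (1 : G)) (hψ.mdifferentiable (by simp) 1)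
    (hφ.mdifferentiable (by simp) 1) h1 v

theorem contMDiff_conj (g : G) : ContMDiff I I ∞ fun y : G => g * y * g⁻¹ :=
  (contMDiff_const.mul contMDiff_id).mul contMDiff_const

/-- The adjoint representation of a Lie group on its tangent space at `1`. -/
def adjointRep : G →* (E →L[ℝ] E) where
  toFun g := mfderivOne I I fun y : G => g * y * g⁻¹
  map_one' := by
    ext v
    have : (fun y : G => 1 * y * 1⁻¹) = id := by ext; simp
    exact mfderiv_apply_of_eq_id this 1 v
  map_mul' g h := by
    ext v
    have hf : (fun y : G => g * h * y * (g * h)⁻¹) =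
        (fun y : G => g * y * g⁻¹) ∘ fun y : G => h * y * h⁻¹ := by
      ext y; simp [mul_assoc]
    rw [hf]
    exact mfderivOne_comp I I (contMDiff_conj I g) (contMDiff_conj I h) (by simp) v

/-- The differential form of `(g * h⁻¹)⁻¹ * (y * h⁻¹) = h * (g⁻¹ * y) * h⁻¹`. -/
theorem maurerCartan_mul_right (h g : G) (v : TangentSpace I g) :
    maurerCartan I (g * h⁻¹) (mfderiv I I (fun y : G => y * h⁻¹) g v) =
      adjointRep I h (maurerCartan I g v) := by
  have hf : (fun y : G => (g * h⁻¹)⁻¹ * y) ∘ (fun y : G => y * h⁻¹) =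
      (fun y : G => h * y * h⁻¹) ∘ fun y : G => g⁻¹ * y := by
    ext y; simp [mul_assoc]
  have h1 := mfderiv_comp_apply (x := g) (mdifferentiable_mul_left_of_lieGroup I (g * h⁻¹)⁻¹ _)
    ((contMDiff_mul_right (I := I) (n := ∞) (a := h⁻¹)).mdifferentiable (by simp) g) v
  have h2 := mfderiv_comp_apply_of_eq (x := g)
    ((contMDiff_conj I h).mdifferentiable (by simp) 1) (mdifferentiable_mul_left_of_lieGroup I g⁻¹ g)
    (inv_mul_cancel g) v
  rw [hf] at h1
  exact h1.symm.trans h2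

/-- A homomorphism of Lie groups intertwines the adjoint representations. -/
theorem mfderivOne_adjointRep (φ : G → N) (hφ : ∀ g h, φ (g * h) = φ g * φ h)
    (hs : ContMDiff I J ∞ φ) (g : G) (v : E) :
    mfderivOne I J φ (adjointRep I g v) = adjointRep J (φ g) (mfderivOne I J φ v) := by
  have h1 : φ 1 = 1 := (MonoidHom.mk' φ hφ).map_one
  have hi : φ g⁻¹ = (φ g)⁻¹ := (MonoidHom.mk' φ hφ).map_inv g
  have hf : φ ∘ (fun y : G => g * y * g⁻¹) = (fun y : N => φ g * y * (φ g)⁻¹) ∘ φ := by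
    ext y; simp [hφ, hi]
  have e1 := mfderivOne_comp I I hs (contMDiff_conj I g) (by simp) v
  have e2 := mfderivOne_comp I J (contMDiff_conj J (φ g)) hs h1 v
  rw [hf] at e1
  exact e1.symm.trans e2

/-- In tangent coordinates, a linear map into the tangent space at `1` is only precomposed with a
trivialization, because the preferred chart at `1` identifies that space with the model space by
the identity. -/
theorem inTangentCoordinates_one_apply {b : G → G} (D : G → E →L[ℝ] E) (x₀ x : G) (v : E) :
    inTangentCoordinates I I b (fun _ => (1 : G)) D x₀ x v =
      D x ((trivializationAt E (TangentSpace I) (b x₀)).symmL ℝ (b x) v) := by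
  have hid (w : E) :
      (trivializationAt E (TangentSpace I) (1 : G)).continuousLinearMapAt ℝ 1 w = w := by
    rw [TangentBundle.continuousLinearMapAt_trivializationAt_eq_core (mem_chart_source H 1)]
    exact (tangentBundleCore I G).coordChange_self _ _ (mem_chart_source H 1) w
  exact hid _

/-- Differentials at `b x` of a smooth family `f x` of maps sending `b x` to `1` depend smoothly on
`x`, in tangent coordinates. -/
theorem contMDiffAt_inTangentCoordinates_one {f : G → G → G} {b : G → G}
    {D : G → E →L[ℝ] E} (hD : ∀ x, D x = (mfderiv I I (f x) (b x) :))
    (hf : ContMDiff (I.prod I) I ∞ (Function.uncurry f)) (hb : ContMDiff I I ∞ b)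
    (h1 : ∀ x, f x (b x) = 1) (x₀ : G) :
    ContMDiffAt I 𝓘(ℝ, E →L[ℝ] E) ∞
      (inTangentCoordinates I I b (fun _ => (1 : G)) D x₀) x₀ := by
  rw [show D = fun x => (mfderiv I I (f x) (b x) :) from funext hD]
  have h := ContMDiffAt.mfderiv (m := ∞) f b (hf.contMDiffAt (x := (x₀, b x₀)))
    hb.contMDiffAt (by simp)
  rwa [show (fun x => f x (b x)) = fun _ => 1 from funext h1] at h

theorem continuous_adjointRep : Continuous (adjointRep I : G → E →L[ℝ] E) := by
  have hs : ContMDiff (I.prod I) I ∞ (Function.uncurry fun g y : G => g * y * g⁻¹) :=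
    (contMDiff_fst.mul contMDiff_snd).mul contMDiff_fst.inv
  refine continuous_iff_continuousAt.mpr fun g₀ => ?_
  convert (contMDiffAt_inTangentCoordinates_one I (D := adjointRep I) (fun _ => rfl) hs
    (contMDiff_const (c := 1)) (fun g => by simp) g₀).continuousAt using 1
  ext g v
  have hid : (trivializationAt E (TangentSpace I) (1 : G)).symmL ℝ 1 v = v := by
    rw [TangentBundle.symmL_trivializationAt_eq_core (mem_chart_source H 1)]
    exact (tangentBundleCore I G).coordChange_self _ _ (mem_chart_source H 1) v
  rw [inTangentCoordinates_one_apply]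
  exact congrArg (adjointRep I g) hid.symm

/-! ### Left-invariant metrics -/

section Metric
variable [FiniteDimensional ℝ E]

open Bundle in
variable {I} in
omit [FiniteDimensional ℝ E] in
theorem inCoordinates_tangent_bilinear_apply {x₀ x : G}
    (hx : x ∈ (trivializationAt E (TangentSpace I : G → Type _) x₀).baseSet)
    (β : TangentSpace I x →L[ℝ] TangentSpace I x →L[ℝ] ℝ) (v w : E) :
    ContinuousLinearMap.inCoordinates E (TangentSpace I) (E →L[ℝ] ℝ)
      (fun y : G => TangentSpace I y →L[ℝ] ℝ) x₀ x x₀ x β v w =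
      β ((trivializationAt E (TangentSpace I) x₀).symmL ℝ x v)
        ((trivializationAt E (TangentSpace I) x₀).symmL ℝ x w) := by
  have h := inCoordinates_apply_eq₂ (F₃ := ℝ) (E₃ := Bundle.Trivial G ℝ) (ϕ := β) (v := v) (w := w) hx hx
    (Set.mem_univ _)
  rw [Bundle.Trivialization.symmL_apply _ hx, Bundle.Trivialization.symmL_apply _ hx]
  simpa using! h

variable {I} in
/-- The left-invariant bilinear form on the tangent bundle with value `B` at `1`. -/
def leftInvariantForm (B : E →L[ℝ] E →L[ℝ] ℝ) (g : G) :
    TangentSpace I g →L[ℝ] TangentSpace I g →L[ℝ] ℝ :=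
  (B.bilinearComp (maurerCartan I g) (maurerCartan I g) :)

open Bundle in
/-- The left-invariant metric which extends a scalar product on the tangent space at `1`. -/
def leftInvariantMetric {B : E →L[ℝ] E →L[ℝ] ℝ} (hB : IsScalarProduct B) : SmoothMetric I G where
  inner := leftInvariantForm B
  symm _ _ _ := hB.symm _ _
  pos g v hv := (hB.bilinearComp (maurerCartan I g) (maurerCartan_bijective I g).1).pos v hv
  isVonNBounded g :=
    (hB.bilinearComp (maurerCartan I g) (maurerCartan_bijective I g).1).isVonNBounded
  contMDiff x₀ := by
    have hs : ContMDiff (I.prod I) I ∞ (Function.uncurry fun g y : G => g⁻¹ * y) :=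
      contMDiff_fst.inv.mul contMDiff_snd
    have hC := contMDiffAt_inTangentCoordinates_one I (D := maurerCartan I) (fun _ => rfl) hs
      contMDiff_id
      (fun g => inv_mul_cancel g) x₀
    rw [contMDiffAt_hom_bundle]
    refine ⟨contMDiffAt_id, ?_⟩
    refine ContMDiffAt.congr_of_eventuallyEq (hC.clm_precomp (F₃ := ℝ) |>.clm_comp
      (contMDiffAt_const (c := B) |>.clm_comp hC)) ?_
    filter_upwards [(trivializationAt E (TangentSpace I) x₀).open_baseSet.mem_nhds
      (mem_baseSet_trivializationAt E (TangentSpace I) x₀)] with x hx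
    ext v w
    -- in coordinates, the form is the pullback of the constant `B` by the Maurer–Cartan form
    refine (inCoordinates_tangent_bilinear_apply hx (leftInvariantForm B x) v w).trans ?_
    change _ = B (inTangentCoordinates I I id (fun _ => (1 : G)) (maurerCartan I) x₀ x v)
      (inTangentCoordinates I I id (fun _ => (1 : G)) (maurerCartan I) x₀ x w)
    rw [inTangentCoordinates_one_apply, inTangentCoordinates_one_apply]
    rfl

theorem leftInvariantMetric_inner {B : E →L[ℝ] E →L[ℝ] ℝ} (hB : IsScalarProduct B) (g : G)
    (v w : TangentSpace I g) :
    (leftInvariantMetric I (G := G) hB).inner g v w = B (maurerCartan I g v) (maurerCartan I g w) :=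
  rfl

theorem isMetricIsometry_mul_left {B : E →L[ℝ] E →L[ℝ] ℝ} (hB : IsScalarProduct B) (h : G) :
    IsMetricIsometry (leftInvariantMetric I (G := G) hB) (fun y => h * y) := by
  refine ⟨⟨⟨Equiv.mulLeft h, contMDiff_mul_left, contMDiff_mul_left⟩, rfl⟩, fun x v w => ?_⟩
  rw [leftInvariantMetric_inner, leftInvariantMetric_inner, maurerCartan_mul_left,
    maurerCartan_mul_left]

/-- A left-invariant metric is also right-invariant when its value at `1` is `Ad`-invariant. -/
theorem isMetricIsometry_mul_right {B : E →L[ℝ] E →L[ℝ] ℝ} (hB : IsScalarProduct B)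
    (hAd : ∀ (g : G) v w, B (adjointRep I g v) (adjointRep I g w) = B v w) (h : G) :
    IsMetricIsometry (leftInvariantMetric I (G := G) hB) (fun y => y * h⁻¹) := by
  refine ⟨⟨⟨Equiv.mulRight h⁻¹, contMDiff_mul_right, contMDiff_mul_right⟩, rfl⟩, fun x v w => ?_⟩
  rw [leftInvariantMetric_inner, leftInvariantMetric_inner, maurerCartan_mul_right,
    maurerCartan_mul_right, hAd]

theorem isMetricIsometry_of_involutive_hom {B : E →L[ℝ] E →L[ℝ] ℝ} (hB : IsScalarProduct B)
    (φ : G → G) (hφ : ∀ g h, φ (g * h) = φ g * φ h) (hs : ContMDiff I I ∞ φ)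
    (hinv : Function.Involutive φ)
    (hφB : ∀ v w, B (mfderivOne I I φ v) (mfderivOne I I φ w) = B v w) :
    IsMetricIsometry (leftInvariantMetric I (G := G) hB) φ := by
  refine ⟨⟨⟨hinv.toPerm, hs, hs⟩, rfl⟩, fun x v w => ?_⟩
  rw [leftInvariantMetric_inner, leftInvariantMetric_inner, maurerCartan_hom I I φ hφ hs,
    maurerCartan_hom I I φ hφ hs, hφB]

/-- Whether a homomorphism is a Riemannian submersion for left-invariant metrics can be tested
at `1`. -/
theorem isRiemannianSubmersion_hom [FiniteDimensional ℝ F] {B : E →L[ℝ] E →L[ℝ] ℝ}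
    (hB : IsScalarProduct B) {B' : F →L[ℝ] F →L[ℝ] ℝ} (hB' : IsScalarProduct B')
    (φ : G → N) (hφ : ∀ g h, φ (g * h) = φ g * φ h) (hsurj : Function.Surjective φ)
    (hsub : Manifold.IsSubmersion I J ∞ φ)
    (hBB' : ∀ v w, (∀ k, mfderivOne I J φ k = 0 → B v k = 0) →
      (∀ k, mfderivOne I J φ k = 0 → B w k = 0) →
      B' (mfderivOne I J φ v) (mfderivOne I J φ w) = B v w) :
    IsRiemannianSubmersion (leftInvariantMetric I (G := G) hB)
      (leftInvariantMetric J (G := N) hB') φ := by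
  have hs := hsub.contMDiff
  refine ⟨hsurj, hsub, fun x v w hv hw => ?_⟩
  have key : ∀ u : TangentSpace I x, (∀ k : TangentSpace I x, mfderiv I J φ x k = 0 →
      (leftInvariantMetric I (G := G) hB).inner x u k = 0) →
      ∀ k, mfderivOne I J φ k = 0 → B (maurerCartan I x u) k = 0 := by
    intro u hu k hk
    obtain ⟨k, rfl⟩ := (maurerCartan_bijective I x).2 k
    exact hu k ((mfderivOne_maurerCartan_eq_zero_iff I J φ hφ hs x k).mp hk)
  rw [leftInvariantMetric_inner, leftInvariantMetric_inner, maurerCartan_hom I J φ hφ hs,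
    maurerCartan_hom I J φ hφ hs]
  exact hBB' _ _ (key v hv) (key w hw)

end Metric

end LieGroup

/-! ### Bi-invariant 1-metrics on compact Lie 2-groups -/

namespace LieGroupoid

variable
    {E₁ : Type*} [NormedAddCommGroup E₁] [NormedSpace ℝ E₁] {H₁ : Type*} [TopologicalSpace H₁]
    {I₁ : ModelWithCorners ℝ E₁ H₁}
    {E₀ : Type*} [NormedAddCommGroup E₀] [NormedSpace ℝ E₀] {H₀ : Type*} [TopologicalSpace H₀]
    {I₀ : ModelWithCorners ℝ E₀ H₀}
    {X₁ : Type*} [TopologicalSpace X₁] [ChartedSpace H₁ X₁] [IsManifold I₁ ∞ X₁]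
    {X₀ : Type*} [TopologicalSpace X₀] [ChartedSpace H₀ X₀] [IsManifold I₀ ∞ X₀]

theorem inv_involutive (X : LieGroupoid I₁ I₀ X₁ X₀) : Function.Involutive X.inv := by
  intro p
  calc X.inv (X.inv p) = X.comp (X.comp p (X.inv p)) (X.inv (X.inv p)) := by
        rw [X.comp_inv]
        conv_rhs => rw [← X.src_inv p, ← X.tgt_inv (X.inv p), X.unit_comp]
    _ = X.comp p (X.comp (X.inv p) (X.inv (X.inv p))) :=
        X.comp_assoc _ _ _ (X.tgt_inv p).symm (X.tgt_inv _).symm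
    _ = p := by rw [X.comp_inv, X.tgt_inv, X.comp_unit]

end LieGroupoid

namespace LieTwoGroup

variable
    {E₁ : Type*} [NormedAddCommGroup E₁] [NormedSpace ℝ E₁] [FiniteDimensional ℝ E₁]
    {H₁ : Type*} [TopologicalSpace H₁] {I₁ : ModelWithCorners ℝ E₁ H₁}
    {E₀ : Type*} [NormedAddCommGroup E₀] [NormedSpace ℝ E₀] [FiniteDimensional ℝ E₀]
    {H₀ : Type*} [TopologicalSpace H₀] {I₀ : ModelWithCorners ℝ E₀ H₀}
    {G₁ : Type*} [Group G₁] [TopologicalSpace G₁] [ChartedSpace H₁ G₁] [LieGroup I₁ ∞ G₁]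
    {G₀ : Type*} [Group G₀] [TopologicalSpace G₀] [ChartedSpace H₀ G₀] [LieGroup I₀ ∞ G₀]
    (G : LieTwoGroup I₁ I₀ G₁ G₀)

omit [FiniteDimensional ℝ E₁] [FiniteDimensional ℝ E₀] in
theorem mfderivOne_inv_inv (v : E₁) :
    mfderivOne I₁ I₁ G.inv (mfderivOne I₁ I₁ G.inv v) = v := by
  have h1 : G.inv 1 = 1 := (MonoidHom.mk' G.inv G.inv_mul).map_one
  rw [← mfderivOne_comp I₁ I₁ G.inv_smooth G.inv_smooth h1]
  exact mfderiv_apply_of_eq_id (I := I₁) (funext G.inv_involutive) (1 : G₁) v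

omit [FiniteDimensional ℝ E₁] [FiniteDimensional ℝ E₀] in
theorem mfderivOne_tgt (v : E₁) :
    mfderivOne I₁ I₀ G.tgt v = mfderivOne I₁ I₀ G.src (mfderivOne I₁ I₁ G.inv v) := by
  have h1 : G.inv 1 = 1 := (MonoidHom.mk' G.inv G.inv_mul).map_one
  rw [← mfderivOne_comp I₁ I₁ G.src_submersion.contMDiff G.inv_smooth h1]
  congr 2
  exact (funext G.src_inv).symm

omit [FiniteDimensional ℝ E₁] [FiniteDimensional ℝ E₀] in
/-- The unit is a section of the source, so its differential is a right inverse. -/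
theorem mfderivOne_src_surjective : Function.Surjective (mfderivOne I₁ I₀ G.src) := by
  intro w
  refine ⟨mfderivOne I₀ I₁ G.unit w, ?_⟩
  rw [← mfderivOne_comp I₀ I₁ G.src_submersion.contMDiff G.unit_smooth G.unit_one]
  exact mfderiv_apply_of_eq_id (I := I₀) (funext G.src_unit) (1 : G₀) w

omit [FiniteDimensional ℝ E₀] in
/-- Averaging over `G₁`, then over the two-element group generated by the groupoid inversion, which
normalizes the adjoint action. -/
theorem exists_isScalarProduct_adjoint_inv [CompactSpace G₁] :
    ∃ B : E₁ →L[ℝ] E₁ →L[ℝ] ℝ, IsScalarProduct B ∧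
      (∀ (g : G₁) v w, B (adjointRep I₁ g v) (adjointRep I₁ g w) = B v w) ∧
      ∀ v w, B (mfderivOne I₁ I₁ G.inv v) (mfderivOne I₁ I₁ G.inv w) = B v w := by
  have : IsTopologicalGroup G₁ := topologicalGroup_of_lieGroup I₁ ∞
  obtain ⟨B, hB, hAd⟩ := exists_isScalarProduct_invariant (adjointRep I₁ (G := G₁))
    (continuous_adjointRep I₁)
  refine ⟨B + B.bilinearComp (mfderivOne I₁ I₁ G.inv) (mfderivOne I₁ I₁ G.inv),
    hB.add (hB.bilinearComp _ (Function.LeftInverse.injective G.mfderivOne_inv_inv)),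
    fun g v w => ?_, fun v w => ?_⟩
  · change B _ _ + B (mfderivOne I₁ I₁ G.inv _) (mfderivOne I₁ I₁ G.inv _) =
      B v w + B (mfderivOne I₁ I₁ G.inv v) (mfderivOne I₁ I₁ G.inv w)
    simp only [mfderivOne_adjointRep I₁ I₁ G.inv G.inv_mul G.inv_smooth, hAd]
  · change B _ _ + B (mfderivOne I₁ I₁ G.inv _) (mfderivOne I₁ I₁ G.inv _) =
      B v w + B (mfderivOne I₁ I₁ G.inv v) (mfderivOne I₁ I₁ G.inv w)
    simp only [G.mfderivOne_inv_inv]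
    exact add_comm _ _

/-- A compact Lie 2-group carries a bi-invariant 1-metric: the metric on arrows is the left-invariant
extension of an invariant scalar product, and the metric on objects that of its quotient along the
source. -/
theorem exists_isBiInvariant [CompactSpace G₁] :
    ∃ η : OneMetric G.toLieGroupoid, G.IsBiInvariant η := by
  obtain ⟨B, hB, hAd, hinv⟩ := G.exists_isScalarProduct_adjoint_inv
  obtain ⟨B', hB', hlift, hquot⟩ := hB.exists_quotient _ G.mfderivOne_src_surjective
  have hker : ∀ (g : G₁) k, mfderivOne I₁ I₀ G.src k = 0 →
      mfderivOne I₁ I₀ G.src (adjointRep I₁ g k) = 0 := fun g k hk => by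
    rw [mfderivOne_adjointRep I₁ I₀ G.src G.src_mul G.src_submersion.contMDiff, hk, map_zero]
  -- the adjoint action of `g` preserves the horizontal space, because that of `g⁻¹` preserves the
  -- kernel
  have hhor : ∀ (g : G₁) v, (∀ k, mfderivOne I₁ I₀ G.src k = 0 → B v k = 0) →
      ∀ k, mfderivOne I₁ I₀ G.src k = 0 → B (adjointRep I₁ g v) k = 0 := fun g v hv k hk => by
    rw [← hAd g⁻¹, ← mul_apply_eq_comp, ← map_mul, inv_mul_cancel, map_one]
    exact hv _ (hker _ _ hk)
  have hAd' : ∀ (a : G₀) v w, B' (adjointRep I₀ a v) (adjointRep I₀ a w) = B' v w := by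
    intro a v w
    obtain ⟨g, rfl⟩ := G.src_surjective a
    obtain ⟨v, rfl, hv⟩ := hlift v
    obtain ⟨w, rfl, hw⟩ := hlift w
    simp only [← mfderivOne_adjointRep I₁ I₀ G.src G.src_mul G.src_submersion.contMDiff]
    rw [hquot _ _ (hhor g v hv) (hhor g w hw), hquot v w hv hw, hAd]
  -- the inversion exchanges the horizontal spaces of source and target, since `tgt = src ∘ inv`
  have htgt : ∀ v, (∀ k, mfderivOne I₁ I₀ G.tgt k = 0 → B v k = 0) →
      ∀ k, mfderivOne I₁ I₀ G.src k = 0 → B (mfderivOne I₁ I₁ G.inv v) k = 0 := by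
    intro v hv k hk
    rw [← hinv, G.mfderivOne_inv_inv]
    exact hv _ (by rw [G.mfderivOne_tgt, G.mfderivOne_inv_inv, hk])
  let η : OneMetric G.toLieGroupoid :=
    { arrMetric := leftInvariantMetric I₁ hB
      objMetric := leftInvariantMetric I₀ hB'
      src_riemannian := isRiemannianSubmersion_hom I₁ I₀ hB hB' G.src G.src_mul G.src_surjective
        G.src_submersion hquot
      tgt_riemannian := isRiemannianSubmersion_hom I₁ I₀ hB hB' G.tgt G.tgt_mul G.tgt_surjective
        G.tgt_submersion fun v w hv hw => by
          rw [G.mfderivOne_tgt, G.mfderivOne_tgt, hquot _ _ (htgt v hv) (htgt w hw), hinv]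
      inv_isometry := isMetricIsometry_of_involutive_hom I₁ hB G.inv G.inv_mul G.inv_smooth
        G.inv_involutive hinv }
  exact ⟨η, ⟨isMetricIsometry_mul_left I₁ hB, isMetricIsometry_mul_left I₀ hB'⟩,
    ⟨isMetricIsometry_mul_right I₁ hB hAd, isMetricIsometry_mul_right I₀ hB' hAd'⟩⟩

end LieTwoGroup

end

theorem mainTheorem3
    {E₁ : Type*} [NormedAddCommGroup E₁] [NormedSpace ℝ E₁] [FiniteDimensional ℝ E₁]
    {E₀ : Type*} [NormedAddCommGroup E₀] [NormedSpace ℝ E₀] [FiniteDimensional ℝ E₀]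
    {G₁ : Type*} [Group G₁] [TopologicalSpace G₁] [ChartedSpace E₁ G₁]
    [LieGroup 𝓘(ℝ, E₁) ∞ G₁]
    {G₀ : Type*} [Group G₀] [TopologicalSpace G₀] [ChartedSpace E₀ G₀]
    [LieGroup 𝓘(ℝ, E₀) ∞ G₀]
    [CompactSpace G₁]
    (G : LieTwoGroup 𝓘(ℝ, E₁) 𝓘(ℝ, E₀) G₁ G₀) :
    (∃ η : OneMetric G.toLieGroupoid,
      G.IsBiInvariant η ∧ G.leftAction.IsIsometric η ∧ G.rightAction.IsIsometric η) ∧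
    G.IsOrthogonal := by
  obtain ⟨η, hη⟩ := G.exists_isBiInvariant
  exact ⟨⟨η, hη, hη.left_isometric, hη.right_isometric⟩, η, hη⟩
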